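/- Let $M$ be a closed oriented 3-manifold and let $b$ be an oriented framed link in $M$ whose components generate $H_1(M,\mathbb Z)$. A graph means a finite graph with univalent vertices (legs) and trivalent vertices, with a cyclic order of the edges at each trivalent vertex, and without components consisting of one edge with two legs. Let $\mathcal B(b)$ be the abelian group generated by graphs whose legs are colored by components of $b$ (extended multilinearly to colors that are formal integral linear combinations of components), modulo the AS, IHX and LOOP relations (LOOP: a graph with an edge from a trivalent vertex to itself is zero). Let $\mathcal A^{\mathrm o}(b)$ be the quotient of $\mathcal B(b)$ by the closed and open brane relations. For a graph $G$ with a distinguished leg $*$, and a leg $l\neq *$ of color $c_l$, let $G_l$ be the result of gluing $*$ to $l$. The closed brane relations are $\sum_{l\ne *}([\Sigma]\cdot[c_l])\,G_l=0$ for all closed surfaces $\Sigma$ in $M$; the open brane relations are $G+\sum_{l\ne *}([\Sigma_0]\cdot[c_l])\,G_l=0$ whenever the color of $*$ is nullhomologous and bounds the surface $\Sigma_0$. Here $\cdot$ denotes the intersection number. Let $G$ be a graph whose $r+1$ legs are colored by formal integral linear combinations $x,y_1,\dots,y_r$ of components of $b$, such that $[x]\in H_1(M,\mathbb Z)$ is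 primitive and no nonzero integral multiple of $[x]$ lies in the span of $[y_1],\dots,[y_r]$. For $k=0,\dots,r$ let $G^{(k)}$ be the sum of the graphs obtained from $G$ in all ways of replacing $k$ of the colors $y_i$ by $x$. An internal edge is an edge between trivalent vertices (possibly equal). (1) If $G$ contains an internal edge and $[x],[y_1],\dots,[y_r]$ are linearly independent, then $G^{(k)}=0$ in $\mathcal A^{\mathrm o}(b)$ for all $k=0,\dots,r$. (2) If the connected component of $G$ that contains the leg colored $x$ contains an internal edge (for instance, if $G$ is connected and contains an internal edge), then $G^{(0)}=G=0$ in $\mathcal A^{\mathrm o}(b)$; if moreover the distinct elements among $[y_1],\dots,[y_r]$ are linearly independent (repetitions being allowed), then $G^{(k)}=0$ in $\mathcal A^{\mathrm o}(b)$ for all $k=0,\dots,r$. -/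

import Mathlib

namespace BraneGraph

noncomputable section

/-! ### Singular chains and first homology -/

/-- Singular `k`-simplices of `X`. -/
abbrev Simp (k : ℕ) (X : Type*) [TopologicalSpace X] := C(stdSimplex ℝ (Fin (k + 1)), X)

/-- Singular `k`-chains of `X` with integer coefficients. -/
abbrev Chain (k : ℕ) (X : Type*) [TopologicalSpace X] := Simp k X →₀ ℤ

/-- The simplex `s` precomposed with the affine map of standard simplices given on vertices
by `f`. -/
def pull {X : Type*} [TopologicalSpace X] {k l : ℕ} (f : Fin (l + 1) → Fin (k + 1))
    (s : Simp k X) : Simp l X :=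
  s.comp ⟨stdSimplex.map f, stdSimplex.continuous_map f⟩

/-- The `i`-th face of a singular simplex. -/
def face {X : Type*} [TopologicalSpace X] {k : ℕ} (i : Fin (k + 2)) (s : Simp (k + 1) X) :
    Simp k X :=
  pull i.succAbove s

/-- The singular boundary operator from `(k + 1)`-chains to `k`-chains. -/
def boundary (k : ℕ) (X : Type*) [TopologicalSpace X] : Chain (k + 1) X →ₗ[ℤ] Chain k X :=
  Finsupp.linearCombination ℤ
    (fun s => ∑ i : Fin (k + 2), (-1 : ℤ) ^ (i : ℕ) • Finsupp.single (face i s) (1 : ℤ))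

/-- Chains all of whose simplices have image in `A`. -/
def chainsIn (k : ℕ) {X : Type*} [TopologicalSpace X] (A : Set X) : Submodule ℤ (Chain k X) :=
  Finsupp.supported ℤ ℤ {s | Set.range s ⊆ A}

/-- The singular homology group `H₁(X; ℤ)`: cycles modulo boundaries. -/
abbrev H1 (X : Type*) [TopologicalSpace X] :=
  LinearMap.ker (boundary 0 X) ⧸
    (LinearMap.range (boundary 1 X)).comap (LinearMap.ker (boundary 0 X)).subtype

/-- The loop `γ`, parametrized as a singular `1`-simplex. -/
def loopSimp {X : Type*} [TopologicalSpace X] (γ : C(Circle, X)) : Simp 1 X :=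
  γ.comp ⟨fun s => Circle.exp (2 * Real.pi * s 1), by
    have h : Continuous fun s : stdSimplex ℝ (Fin 2) => s 1 :=
      (continuous_apply (1 : Fin 2)).comp continuous_subtype_val
    exact Circle.exp.continuous.comp (continuous_const.mul h)⟩

theorem boundary_loopSimp {X : Type*} [TopologicalSpace X] (γ : C(Circle, X)) :
    boundary 0 X (Finsupp.single (loopSimp γ) 1) = 0 := by
  have key : face 0 (loopSimp γ) = face 1 (loopSimp γ) := by
    ext p
    have hp : p = stdSimplex.vertex 0 := Subsingleton.elim _ _
    subst hp
    simp [face, pull, loopSimp, stdSimplex.map_vertex]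
  simp [boundary, Finsupp.linearCombination_single, Fin.sum_univ_two, key]

/-- The homology class of a loop. -/
def loopClass {X : Type*} [TopologicalSpace X] (γ : C(Circle, X)) : H1 X :=
  Submodule.Quotient.mk ⟨Finsupp.single (loopSimp γ) 1, boundary_loopSimp γ⟩

/-! ### Orientations and intersection numbers in a closed 3-manifold -/

/-- `z` is a fundamental cycle of the closed 3-manifold `X`, i.e. a cycle which generates the
local homology `H₃(X, X ∖ p)` at every point `p`. It represents an orientation of `X`. -/
def IsFundamentalCycle {X : Type*} [TopologicalSpace X] (z : Chain 3 X) : Prop :=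
  boundary 2 X z = 0 ∧
    ∀ p : X, ∀ w : Chain 3 X, boundary 2 X w ∈ chainsIn 2 ({p}ᶜ : Set X) →
      ∃ n : ℤ, w - n • z ∈ LinearMap.range (boundary 3 X) ⊔ chainsIn 3 ({p}ᶜ : Set X)

/-- The coboundary of a `1`-cochain, evaluated on a singular `2`-simplex. -/
def coboundary {X : Type*} [TopologicalSpace X] (α : Simp 1 X → ℤ) (s : Simp 2 X) : ℤ :=
  α (face 0 s) - α (face 1 s) + α (face 2 s)

/-- The cap product of a `3`-chain with a `1`-cochain: `s ↦ α(s|[v₀,v₁]) · s|[v₁,v₂,v₃]`. -/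
def cap {X : Type*} [TopologicalSpace X] (α : Simp 1 X → ℤ) : Chain 3 X →ₗ[ℤ] Chain 2 X :=
  Finsupp.linearCombination ℤ
    (fun s : Simp 3 X => Finsupp.single
      (pull (Fin.succ : Fin 3 → Fin 4) s : Simp 2 X)
      (α (pull (Fin.castLE (by omega) : Fin 2 → Fin 4) s)))

/-- `n` is the intersection number `[σ] · [c]` of the `2`-cycle `σ` with the `1`-cycle `c`, in the
closed 3-manifold `X` oriented by `z`: the value on `c` of a cohomology class which is
Poincaré dual to `[σ]`. -/
def IsIntersectionNumber {X : Type*} [TopologicalSpace X] (z : Chain 3 X) (σ : Chain 2 X)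
    (c : Chain 1 X) (n : ℤ) : Prop :=
  ∃ α : Simp 1 X → ℤ, (∀ s, coboundary α s = 0) ∧
    σ - cap α z ∈ LinearMap.range (boundary 2 X) ∧
    n = Finsupp.linearCombination ℤ α c

/-- `n` is the intersection number of the `2`-chain `σ`, whose boundary lies in the compact set
`A` (a link), with the `1`-cycle `c`, which lies in the complement of `A`: the value on `c` of a
cohomology class `α ∈ H¹(X ∖ A)` which is Lefschetz dual to `[σ] ∈ H₂(X, A)`.
Here `α` is a cochain of `X` which is a cocycle on `X ∖ A`, and the duality is expressed by
replacing `z` by a homologous cycle `z'` with simplices so small that each of them avoids `A` or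
lies in a given neighbourhood `N` of `A`; then `z' ∩ α` is a cycle relative to `N`. -/
def IsRelIntersectionNumber {X : Type*} [TopologicalSpace X] (z : Chain 3 X) (A : Set X)
    (σ : Chain 2 X) (c : Chain 1 X) (n : ℤ) : Prop :=
  ∃ α : Simp 1 X → ℤ, (∀ s : Simp 2 X, Set.range s ⊆ Aᶜ → coboundary α s = 0) ∧
    (∀ N : Set X, IsOpen N → A ⊆ N → ∃ z' : Chain 3 X,
      z - z' ∈ LinearMap.range (boundary 3 X) ∧
      (∀ s ∈ z'.support, Set.range s ⊆ N ∨ Set.range s ⊆ Aᶜ) ∧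
      σ - cap α z' ∈ LinearMap.range (boundary 2 X) ⊔ chainsIn 2 N) ∧
    n = Finsupp.linearCombination ℤ α c

/-! ### Framed links -/

/-- An oriented framed link in `X` with components indexed by `ι`: disjoint embedded solid tori,
each with its parametrization by `S¹ × D²`. -/
structure FramedLink (ι : Type*) (X : Type*) [TopologicalSpace X] where
  tube : ι → C(Circle × Metric.closedBall (0 : ℂ) 1, X)
  isEmbedding : ∀ i, Topology.IsEmbedding (tube i)
  disjoint : ∀ i j, i ≠ j → Disjoint (Set.range (tube i)) (Set.range (tube j))

namespace FramedLink

variable {ι : Type*} {X : Type*} [TopologicalSpace X]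

/-- The parallel copy of the `i`-th component through the point `v` of the disk. -/
def parallel (b : FramedLink ι X) (v : Metric.closedBall (0 : ℂ) 1) (i : ι) : C(Circle, X) :=
  (b.tube i).comp ⟨fun t => (t, v), by fun_prop⟩

/-- The `i`-th component of the link. -/
def core (b : FramedLink ι X) (i : ι) : C(Circle, X) :=
  b.parallel ⟨0, by simp⟩ i

/-- The push-off of the `i`-th component along the framing. -/
def pushoff (b : FramedLink ι X) (i : ι) : C(Circle, X) :=
  b.parallel ⟨1, by simp⟩ i

/-- The `1`-cycle of a formal integral linear combination of the components. -/
def cycle (b : FramedLink ι X) (c : ι →₀ ℤ) : Chain 1 X :=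
  Finsupp.linearCombination ℤ (fun i => Finsupp.single (loopSimp (b.core i)) (1 : ℤ)) c

/-- The homology class of a formal integral linear combination of the components. -/
def cls (b : FramedLink ι X) : (ι →₀ ℤ) →ₗ[ℤ] H1 X :=
  Finsupp.linearCombination ℤ (fun i => loopClass (b.core i))

/-- The components of the link generate `H₁(X; ℤ)`. -/
def H1Spanning (b : FramedLink ι X) : Prop :=
  Submodule.span ℤ (Set.range fun i => loopClass (b.core i)) = ⊤

end FramedLink

/-! ### Uni-trivalent graphs -/

/-- A graph with univalent and trivalent vertices, with a cyclic order at each trivalent vertex,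
no struts, and legs coloured by formal integral linear combinations of elements of `ι`.
The trivalent vertices are numbered by `Fin n`, and `(v, 0), (v, 1), (v, 2)` are the three
half-edges at `v` in their cyclic order. The involution `edge` exchanges the two half-edges of an
edge between trivalent vertices; its fixed points are the half-edges which lead to a univalent
vertex, and so stand for the legs. Only the values of `color` on legs are meaningful: see
`GraphRel.color`. -/
structure UTGraph (ι : Type*) where
  n : ℕ
  edge : Equiv.Perm (Fin n × Fin 3)
  edge_edge : ∀ d, edge (edge d) = d
  color : Fin n × Fin 3 → (ι →₀ ℤ)

namespace UTGraph

variable {ι : Type*}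

/-- The half-edges at the trivalent vertices. -/
abbrev Dart (G : UTGraph ι) := Fin G.n × Fin 3

/-- `d` leads to a univalent vertex. -/
def IsLeg (G : UTGraph ι) (d : G.Dart) : Prop := G.edge d = d

/-- The legs of the graph. -/
abbrev Leg (G : UTGraph ι) := {d : G.Dart // G.IsLeg d}

/-- The graph with the same half-edges and other colours. -/
def recolor (G : UTGraph ι) (c : G.Dart → (ι →₀ ℤ)) : UTGraph ι where
  n := G.n
  edge := G.edge
  edge_edge := G.edge_edge
  color := c

/-- The graph obtained by moving what is attached at each half-edge `d` to the half-edge `ρ d`. -/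
def relabel (G : UTGraph ι) (ρ : Equiv.Perm G.Dart) : UTGraph ι where
  n := G.n
  edge := ρ * G.edge * ρ⁻¹
  edge_edge := fun d => by simp [G.edge_edge]
  color := fun d => G.color (ρ⁻¹ d)

/-- The graph obtained by gluing the legs `s` and `l` to form an edge. -/
def join (G : UTGraph ι) (s l : G.Leg) : UTGraph ι where
  n := G.n
  edge := Equiv.swap s.1 l.1 * G.edge
  edge_edge := fun d => by
    have hs : G.edge s.1 = s.1 := s.2
    have hl : G.edge l.1 = l.1 := l.2
    have h : G.edge * Equiv.swap s.1 l.1 = Equiv.swap s.1 l.1 * G.edge := by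
      rw [Equiv.mul_swap_eq_swap_mul, hs, hl]
    have h2 := congrArg (fun f : Equiv.Perm G.Dart => f (G.edge d)) h
    simp only [Equiv.Perm.mul_apply, G.edge_edge] at h2
    simp only [Equiv.Perm.mul_apply]
    rw [← Equiv.Perm.mul_apply G.edge, h, Equiv.Perm.mul_apply, G.edge_edge,
      Equiv.swap_apply_self]
  color := G.color

/-- `d` is one half of an internal edge, an edge between two trivalent vertices. -/
def IsInternal (G : UTGraph ι) (d : G.Dart) : Prop := G.edge d ≠ d

/-- `d` and `d'` lie in the same connected component. -/
def SameComponent (G : UTGraph ι) (d d' : G.Dart) : Prop :=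
  Relation.EqvGen (fun a b : G.Dart => a.1 = b.1 ∨ G.edge a = b) d d'

end UTGraph

open UTGraph

/-- The defining relations: isomorphism of graphs, irrelevance of `color` off the legs, the
multilinear extension of colourings, AS, IHX and LOOP. -/
inductive GraphRel (ι : Type*) : FreeAbelianGroup (UTGraph ι) → Prop
  /-- Isomorphism: a bijection of half-edges which respects vertices and cyclic orders. -/
  | iso (G : UTGraph ι) (ρ : Equiv.Perm G.Dart)
      (hρ : ∀ v i, ρ (v, i + 1) = ((ρ (v, i)).1, (ρ (v, i)).2 + 1)) :
      GraphRel ι (FreeAbelianGroup.of (G.relabel ρ) - FreeAbelianGroup.of G)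
  | color (G : UTGraph ι) (c : G.Dart → (ι →₀ ℤ)) (hc : ∀ d, G.IsLeg d → c d = G.color d) :
      GraphRel ι (FreeAbelianGroup.of (G.recolor c) - FreeAbelianGroup.of G)
  | linear (G : UTGraph ι) (d : G.Dart) (hd : G.IsLeg d) (c c' : ι →₀ ℤ) :
      GraphRel ι (FreeAbelianGroup.of (G.recolor (Function.update G.color d (c + c'))) -
        FreeAbelianGroup.of (G.recolor (Function.update G.color d c)) -
        FreeAbelianGroup.of (G.recolor (Function.update G.color d c')))
  /-- AS: reversing the cyclic order at one vertex changes the sign. -/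
  | antisymm (G : UTGraph ι) (v : Fin G.n) :
      GraphRel ι (FreeAbelianGroup.of (G.relabel (Equiv.swap (v, 1) (v, 2))) +
        FreeAbelianGroup.of G)
  /-- IHX at an edge from `(u, 0)` to `(v, 0)`: the sum over the cyclic permutations of the ends
  attached at `(u, 1)`, `(u, 2)`, `(v, 1)`. -/
  | ihx (G : UTGraph ι) (u v : Fin G.n) (huv : u ≠ v) (he : G.edge (u, 0) = (v, 0))
      (ρ : Equiv.Perm G.Dart)
      (hρ : ρ = Equiv.swap (u, 1) (u, 2) * Equiv.swap (u, 2) (v, 1)) :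
      GraphRel ι (FreeAbelianGroup.of G + FreeAbelianGroup.of (G.relabel ρ) +
        FreeAbelianGroup.of (G.relabel (ρ * ρ)))
  /-- LOOP: a graph with an edge from a vertex to itself vanishes. -/
  | loop (G : UTGraph ι) (v : Fin G.n) (i j : Fin 3) (hij : i ≠ j)
      (he : G.edge (v, i) = (v, j)) :
      GraphRel ι (FreeAbelianGroup.of G)

/-- The group `ℬ(ι)` of `ι`-coloured graphs modulo AS, IHX and LOOP. -/
abbrev GraphGroup (ι : Type*) :=
  FreeAbelianGroup (UTGraph ι) ⧸ AddSubgroup.closure {g | GraphRel ι g}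

/-- The class of a graph in `ℬ(ι)`. -/
def UTGraph.toGroup {ι : Type*} (G : UTGraph ι) : GraphGroup ι :=
  QuotientAddGroup.mk (FreeAbelianGroup.of G)

open Classical in
/-- `∑_l m(c_l) G_l`, over the legs `l ≠ s` of `G`, where `c_l` is the colour of `l`, `G_l` is the
result of gluing the leg `s` to `l`, and `m : ι → ℤ` is extended linearly. -/
def glueSum {ι : Type*} (G : UTGraph ι) (s : G.Leg) (m : ι → ℤ) : GraphGroup ι :=
  ∑ l : {l : G.Leg // l ≠ s},
    Finsupp.linearCombination ℤ m (G.color l.1.1) • (G.join s l.1).toGroup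

/-- The closed brane subgroup: generated by `⟨G, Σ⟩ = ∑_l ([Σ] · [c_l]) G_l` for all graphs `G`
with a distinguished leg `s` (whose colour plays no role) and all `[Σ] ∈ H₂(X; ℤ)`. -/
def closedBrane {ι : Type*} {X : Type*} [TopologicalSpace X] (z : Chain 3 X)
    (b : FramedLink ι X) : AddSubgroup (GraphGroup ι) :=
  AddSubgroup.closure
    {g | ∃ (G : UTGraph ι) (s : G.Leg) (σ : Chain 2 X) (m : ι → ℤ),
      boundary 1 X σ = 0 ∧
      (∀ i, IsIntersectionNumber z σ (Finsupp.single (loopSimp (b.core i)) 1) (m i)) ∧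
      g = glueSum G s m}

/-- The open brane subgroup: generated by `⟨G, Σ₀⟩ = G + ∑_l ([Σ₀] · [c_l]) G_l` for all graphs
`G` with a distinguished leg `s` whose colour `c₀` is nullhomologous, and all `Σ₀` with boundary
`c₀`. The colours of the other legs are realized by push-offs, which are disjoint from `c₀`. -/
def openBrane {ι : Type*} {X : Type*} [TopologicalSpace X] (z : Chain 3 X)
    (b : FramedLink ι X) : AddSubgroup (GraphGroup ι) :=
  AddSubgroup.closure
    {g | ∃ (G : UTGraph ι) (s : G.Leg) (σ : Chain 2 X) (m : ι → ℤ),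
      boundary 1 X σ = b.cycle (G.color s.1) ∧
      (∀ i, IsRelIntersectionNumber z (⋃ j ∈ (G.color s.1).support, Set.range (b.core j)) σ
        (Finsupp.single (loopSimp (b.pushoff i)) 1) (m i)) ∧
      g = G.toGroup + glueSum G s m}

/-- The group `𝒜ᵒ(b)`: the quotient of `ℬ(b)` by the closed and open brane relations. -/
abbrev OpenBraneGroup {ι : Type*} {X : Type*} [TopologicalSpace X] (z : Chain 3 X)
    (b : FramedLink ι X) :=
  GraphGroup ι ⧸ (closedBrane z b ⊔ openBrane z b)

/-- The class of a graph in `𝒜ᵒ(b)`. -/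
def UTGraph.toOpenBrane {ι : Type*} {X : Type*} [TopologicalSpace X] (z : Chain 3 X)
    (b : FramedLink ι X) (G : UTGraph ι) : OpenBraneGroup z b :=
  QuotientAddGroup.mk G.toGroup

/-! ### Replacing colours -/

open Classical in
/-- For a graph with legs numbered `0, …, r`: the graph obtained by giving the colour of leg `0`
to all the legs `i + 1` with `i ∈ S`. -/
def UTGraph.replace {ι : Type*} (G : UTGraph ι) {r : ℕ} (leg : Fin (r + 1) ≃ G.Leg)
    (S : Finset (Fin r)) : UTGraph ι :=
  G.recolor fun d => if ∃ i ∈ S, (leg i.succ).1 = d then G.color (leg 0).1 else G.color d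

/-- `G⁽ᵏ⁾`: the sum over all ways of replacing `k` of the colours of the legs `1, …, r` by the
colour of leg `0`. -/
def replaceSum {ι : Type*} {X : Type*} [TopologicalSpace X] (z : Chain 3 X)
    (b : FramedLink ι X) (G : UTGraph ι) {r : ℕ} (leg : Fin (r + 1) ≃ G.Leg) (k : ℕ) :
    OpenBraneGroup z b :=
  ∑ S ∈ Finset.powersetCard k (Finset.univ : Finset (Fin r)), (G.replace leg S).toOpenBrane z b

/-- An element of an abelian group is primitive if it is not a proper multiple. -/
def IsPrimitiveElement {A : Type*} [AddCommGroup A] (a : A) : Prop :=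
  ∀ (n : ℤ) (u : A), a = n • u → IsUnit n

end

end BraneGraph

open BraneGraph

/-! ### Singular chains: homomorphisms `H₁ → ℤ` come from closed surfaces -/

section Topology

variable {X : Type*} [TopologicalSpace X]

/-! Only closed brane relations are needed. Every homomorphism `h : H₁(M) → ℤ` is evaluation of a
cocycle, and capping the fundamental cycle with that cocycle gives a closed surface with
intersection numbers `h` (`glueSum_mem_closedBrane`). Cut an internal edge `f` of `G`, colour one
new leg by `u`, and apply the relation at the other: `h(u) G + ∑ h(c_l) G_{f,l} = 0`, where
`G_{f,l}` has `f` glued to the old leg `l` (`smul_colored_add_sum_coloredGlue_cut`).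

If `f` shares its vertex with the leg coloured `x`, gluing `f` to that leg makes a loop, so this
term is zero. With `h(u) = 1` and `h(y_i) = 0` this gives `G = 0` (`colored_eq_zero_of_adjacent`).
In (2) such an `f` exists.

In (1) the rank of `H₁` exceeds `r`, so any `r` classes are killed by some surjective `h`. If a leg
lies on a component with one trivalent vertex and three legs, gluing `f` to it creates an internal
edge adjacent to another leg, and a second functional kills the glued graph. This works for every
colouring, so each term of `G⁽ᵏ⁾` vanishes (`colored_eq_zero_of_card_le`).

For `k > 0` in (2), choose `l` with a common value `d` on all `y_i`, and `e` in the saturation of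
their span with `l(e) = 1`. Write `y_i = v_i + d e` and expand: slots carry `v_i` or `e`, and `h`
kills both. The relations of `h` and of `h₁ = h(x) l - l(x) h`, which kills `x`, express the sum
with `k + 1` replacements as `h₁(u)` times the sum with `k`; induction finishes
(`sum_weighted_replace_eq_zero`). -/

theorem pull_pull {k l m : ℕ} (f : Fin (l + 1) → Fin (k + 1)) (g : Fin (m + 1) → Fin (l + 1))
    (s : Simp k X) : pull g (pull f s) = pull (f ∘ g) s := by
  ext p
  simp [pull, stdSimplex.map_comp_apply]

theorem boundary_zero_single (s : Simp 1 X) : boundary 0 X (Finsupp.single s 1) =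
    Finsupp.single (face 0 s) 1 - Finsupp.single (face 1 s) 1 := by
  simp [boundary, Fin.sum_univ_two, sub_eq_add_neg]

theorem boundary_one_single (s : Simp 2 X) : boundary 1 X (Finsupp.single s 1) =
    Finsupp.single (face 0 s) 1 - Finsupp.single (face 1 s) 1 + Finsupp.single (face 2 s) 1 := by
  simp [boundary, Fin.sum_univ_three, sub_eq_add_neg]

theorem boundary_two_single (s : Simp 3 X) : boundary 2 X (Finsupp.single s 1) =
    Finsupp.single (face 0 s) 1 - Finsupp.single (face 1 s) 1 + Finsupp.single (face 2 s) 1 -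
      Finsupp.single (face 3 s) 1 := by
  have h : (-1 : ℤ) ^ 3 = -1 := by norm_num
  simp [boundary, Fin.sum_univ_four, sub_eq_add_neg, h]

theorem boundary_boundary_single (s : Simp 2 X) :
    boundary 0 X (boundary 1 X (Finsupp.single s 1)) = 0 := by
  have h1 : pull (Fin.succAbove (0 : Fin 2)) (pull (Fin.succAbove (0 : Fin 3)) s) =
      pull (Fin.succAbove (0 : Fin 2)) (pull (Fin.succAbove (1 : Fin 3)) s) := by
    rw [pull_pull, pull_pull]; congr 1
  have h2 : pull (Fin.succAbove (1 : Fin 2)) (pull (Fin.succAbove (0 : Fin 3)) s) =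
      pull (Fin.succAbove (0 : Fin 2)) (pull (Fin.succAbove (2 : Fin 3)) s) := by
    rw [pull_pull, pull_pull]; congr 1; decide
  have h3 : pull (Fin.succAbove (1 : Fin 2)) (pull (Fin.succAbove (1 : Fin 3)) s) =
      pull (Fin.succAbove (1 : Fin 2)) (pull (Fin.succAbove (2 : Fin 3)) s) := by
    rw [pull_pull, pull_pull]; congr 1; decide
  simp only [boundary_one_single, boundary_zero_single, map_add, map_sub, face, h1, h2, h3]
  abel

/-- Choose in each class of homologous points a representative, and for each point `a` a chain `t a`
with boundary `a - rep a`. Then `c ↦ c - t(∂c)` fixes cycles, and its values are cycles because both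
ends of an edge have the same representative. -/
theorem exists_projection_cycles :
    ∃ p : Chain 1 X →ₗ[ℤ] LinearMap.ker (boundary 0 X), ∀ a : LinearMap.ker (boundary 0 X),
      p a = a := by
  let R : Setoid (Simp 0 X) :=
    { r := fun a b => Finsupp.single a (1 : ℤ) - Finsupp.single b 1 ∈
        LinearMap.range (boundary 0 X)
      iseqv :=
        { refl := fun a => by simp
          symm := fun {a b} h => by simpa using neg_mem h
          trans := fun {a b c} h h' => by simpa using add_mem h h' } }
  let rep : Simp 0 X → Simp 0 X := fun a => (Quotient.mk R a).out
  have hrep : ∀ a, Finsupp.single a (1 : ℤ) - Finsupp.single (rep a) 1 ∈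
      LinearMap.range (boundary 0 X) := fun a => R.symm (Quotient.mk_out (s := R) a)
  choose t ht using hrep
  have hface : ∀ e : Simp 1 X, rep (face 0 e) = rep (face 1 e) := fun e => by
    refine congrArg Quotient.out (Quotient.sound (s := R) ⟨Finsupp.single e 1, boundary_zero_single e⟩)
  let q : Chain 1 X →ₗ[ℤ] Chain 1 X :=
    LinearMap.id - Finsupp.linearCombination ℤ t ∘ₗ boundary 0 X
  have hq : boundary 0 X ∘ₗ q = 0 := by
    ext1 e
    ext1
    have h0 := ht (face 0 e)
    have h1 := ht (face 1 e)
    rw [hface] at h0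
    simp only [LinearMap.comp_apply, Finsupp.lsingle_apply, q, LinearMap.sub_apply,
      LinearMap.id_apply, map_sub, boundary_zero_single, Finsupp.linearCombination_single, one_smul, h0, h1]
    simp
  refine ⟨LinearMap.codRestrict _ q fun c => LinearMap.mem_ker.mpr (LinearMap.congr_fun hq c), fun a => ?_⟩
  ext1
  rw [LinearMap.codRestrict_apply]
  simp [q, LinearMap.mem_ker.mp a.2]

/-- Every homomorphism `H₁(X; ℤ) → ℤ` is the evaluation of a cocycle. -/
theorem exists_cocycle_of_hom (h : H1 X →ₗ[ℤ] ℤ) :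
    ∃ α : Simp 1 X → ℤ, (∀ s, coboundary α s = 0) ∧
      ∀ γ : C(Circle, X), α (loopSimp γ) = h (loopClass γ) := by
  obtain ⟨q, hq⟩ := exists_projection_cycles (X := X)
  let L : Chain 1 X →ₗ[ℤ] ℤ := h ∘ₗ Submodule.mkQ _ ∘ₗ q
  refine ⟨fun s => L (Finsupp.single s 1), fun s => ?_, fun γ => ?_⟩
  · have hb : boundary 0 X (boundary 1 X (Finsupp.single s 1)) = 0 :=
      boundary_boundary_single s
    have h0 : L (boundary 1 X (Finsupp.single s 1)) = 0 := by
      have h1 := hq ⟨_, hb⟩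
      simp only at h1
      simp only [L, LinearMap.comp_apply, h1]
      have : (Submodule.mkQ ((LinearMap.range (boundary 1 X)).comap
          (LinearMap.ker (boundary 0 X)).subtype)) ⟨_, hb⟩ = 0 := by
        rw [Submodule.mkQ_apply, Submodule.Quotient.mk_eq_zero]
        exact ⟨_, rfl⟩
      rw [this, map_zero]
    rw [← h0]
    simp [boundary_one_single, coboundary]
  · have h1 := hq ⟨_, boundary_loopSimp γ⟩
    simp only at h1
    simp only [L, LinearMap.comp_apply, h1]
    rfl

/-- The cap product of a cycle with a cocycle is a cycle. -/
theorem boundary_cap_eq_zero (α : Simp 1 X → ℤ) (hα : ∀ s, coboundary α s = 0) (z : Chain 3 X)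
    (hz : boundary 2 X z = 0) : boundary 1 X (cap α z) = 0 := by
  let cap2 : Chain 2 X →ₗ[ℤ] Chain 1 X := Finsupp.linearCombination ℤ
    (fun s : Simp 2 X => Finsupp.single (pull (Fin.succ : Fin 2 → Fin 3) s : Simp 1 X)
      (α (pull (Fin.castLE (by omega) : Fin 2 → Fin 3) s)))
  have key : boundary 1 X ∘ₗ cap α = -(cap2 ∘ₗ boundary 2 X) := by
    ext1 s
    ext1
    -- The cocycle condition on the front triangle `[v₀, v₁, v₂]` removes the only term that
    -- obstructs the Leibniz rule.
    have hδ := hα (pull (![0, 1, 2] : Fin 3 → Fin 4) s)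
    simp only [coboundary, face, pull_pull] at hδ
    have hp : ∀ (m : ℕ) (f g : Fin (m + 1) → Fin 4), f = g → pull f s = pull g s :=
      fun m f g h => by rw [h]
    rw [hp 1 (_ ∘ Fin.succAbove 0) ![1, 2] (by decide),
      hp 1 (_ ∘ Fin.succAbove 1) ![0, 2] (by decide),
      hp 1 (_ ∘ Fin.succAbove 2) ![0, 1] (by decide)] at hδ
    have hs : ∀ (t : Simp 2 X) (n : ℤ), Finsupp.single t n = n • Finsupp.single t (1 : ℤ) :=
      fun t n => by simp
    simp only [LinearMap.comp_apply, Finsupp.lsingle_apply, cap, cap2, boundary_two_single,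
      Finsupp.linearCombination_single, one_smul, LinearMap.neg_apply, map_add, map_sub]
    rw [hs, map_smul, boundary_one_single]
    simp only [face, pull_pull]
    rw [hp 1 (Fin.castLE _) ![0, 1] (by decide),
      hp 1 (Fin.succ ∘ Fin.succAbove 0) ![2, 3] (by decide),
      hp 1 (Fin.succ ∘ Fin.succAbove 1) ![1, 3] (by decide),
      hp 1 (Fin.succ ∘ Fin.succAbove 2) ![1, 2] (by decide),
      hp 1 (Fin.succAbove 0 ∘ Fin.succ) ![2, 3] (by decide),
      hp 1 (Fin.succAbove 1 ∘ Fin.succ) ![2, 3] (by decide),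
      hp 1 (Fin.succAbove 2 ∘ Fin.succ) ![1, 3] (by decide),
      hp 1 (Fin.succAbove 3 ∘ Fin.succ) ![1, 2] (by decide),
      hp 1 (Fin.succAbove 0 ∘ Fin.castLE _) ![1, 2] (by decide),
      hp 1 (Fin.succAbove 1 ∘ Fin.castLE _) ![0, 2] (by decide),
      hp 1 (Fin.succAbove 2 ∘ Fin.castLE _) ![0, 1] (by decide),
      hp 1 (Fin.succAbove 3 ∘ Fin.castLE _) ![0, 1] (by decide)]
    have h02 : α (pull ![0, 2] s) = α (pull ![1, 2] s) + α (pull ![0, 1] s) := by linarith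
    rw [h02, Finsupp.single_add]
    simp only [smul_add, smul_sub, Finsupp.smul_single, smul_eq_mul, mul_one]
    abel
  have := LinearMap.congr_fun key z
  simpa [hz] using this

/-- Every homomorphism `H₁(X; ℤ) → ℤ` is the intersection with a closed surface. -/
theorem glueSum_mem_closedBrane {ι : Type*} (z : Chain 3 X) (hz : boundary 2 X z = 0)
    (b : FramedLink ι X) (h : H1 X →ₗ[ℤ] ℤ) (G : UTGraph ι) (s : G.Leg) :
    glueSum G s (fun i => h (loopClass (b.core i))) ∈ closedBrane z b := by
  obtain ⟨α, hα, hl⟩ := exists_cocycle_of_hom h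
  -- The surface is the cap product itself, so it is dual to `α` by construction and the
  -- surjectivity of Poincaré duality is never used.
  refine AddSubgroup.subset_closure ⟨G, s, cap α z, _, boundary_cap_eq_zero α hα z hz,
    fun i => ⟨α, hα, by simp, ?_⟩, rfl⟩
  simp [hl]

end Topology

/-! ### Cutting an internal edge and the resulting vanishing criteria -/

namespace BraneGraph.UTGraph

variable {ι : Type*} {X : Type*} [TopologicalSpace X] {z : Chain 3 X} {b : FramedLink ι X}
variable {G : UTGraph ι}

noncomputable instance (G : UTGraph ι) : DecidablePred G.IsLeg := fun _ =>
  Classical.propDecidable _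

/-- The class in `𝒜ᵒ(b)` of the graph with colours `c`. -/
noncomputable def colored (z : Chain 3 X) (b : FramedLink ι X) (G : UTGraph ι)
    (c : G.Dart → (ι →₀ ℤ)) : OpenBraneGroup z b :=
  (G.recolor c).toOpenBrane z b

theorem toGroup_eq {G H : UTGraph ι}
    (h : GraphRel ι (FreeAbelianGroup.of G - FreeAbelianGroup.of H)) : G.toGroup = H.toGroup := by
  rw [← sub_eq_zero]
  exact (QuotientAddGroup.eq_zero_iff _).mpr (AddSubgroup.subset_closure h)

theorem colored_congr {c c' : G.Dart → (ι →₀ ℤ)} (h : ∀ d, G.IsLeg d → c d = c' d) :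
    colored z b G c = colored z b G c' := by
  have := toGroup_eq (GraphRel.color (G.recolor c') c h)
  exact congrArg (QuotientAddGroup.mk (s := closedBrane z b ⊔ openBrane z b)) this

theorem colored_update_add {d : G.Dart} (hd : G.IsLeg d) (c : G.Dart → (ι →₀ ℤ)) (a a' : ι →₀ ℤ) :
    colored z b G (Function.update c d (a + a')) =
      colored z b G (Function.update c d a) + colored z b G (Function.update c d a') := by
  have h : ((G.recolor (Function.update c d (a + a'))).toGroup -
      (G.recolor (Function.update c d a)).toGroup -
      (G.recolor (Function.update c d a')).toGroup : GraphGroup ι) = 0 :=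
    (QuotientAddGroup.eq_zero_iff _).mpr
      (AddSubgroup.subset_closure (GraphRel.linear (G.recolor c) d hd a a'))
  have h' : (G.recolor (Function.update c d (a + a'))).toGroup =
      (G.recolor (Function.update c d a)).toGroup +
      (G.recolor (Function.update c d a')).toGroup := by
    rw [sub_sub, sub_eq_zero] at h
    exact h
  exact congrArg (QuotientAddGroup.mk (s := closedBrane z b ⊔ openBrane z b)) h'

theorem colored_eq_zero_of_loop {c : G.Dart → (ι →₀ ℤ)} {d d' : G.Dart} (hd : d.1 = d'.1)
    (hne : d ≠ d') (he : G.edge d = d') : colored z b G c = 0 := by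
  obtain ⟨v, i⟩ := d
  obtain ⟨w, j⟩ := d'
  obtain rfl : v = w := hd
  have : (G.recolor c).toGroup = 0 := (QuotientAddGroup.eq_zero_iff _).mpr
    (AddSubgroup.subset_closure
      (GraphRel.loop (G.recolor c) v i j (fun h => hne (by rw [h])) he))
  rw [colored, toOpenBrane, this]
  rfl

/-- The class of the graph with colours `c` in which the legs `s` and `l` are glued. -/
noncomputable def coloredGlue (z : Chain 3 X) (b : FramedLink ι X) (G : UTGraph ι)
    (s l : G.Dart) (c : G.Dart → (ι →₀ ℤ)) : OpenBraneGroup z b :=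
  if h : G.IsLeg s ∧ G.IsLeg l then colored z b (G.join ⟨s, h.1⟩ ⟨l, h.2⟩) c else 0

theorem linearCombination_loopClass (b : FramedLink ι X) (h : H1 X →ₗ[ℤ] ℤ) (c : ι →₀ ℤ) :
    Finsupp.linearCombination ℤ (fun i => h (loopClass (b.core i))) c = h (b.cls c) := by
  rw [FramedLink.cls, Finsupp.apply_linearCombination]
  rfl

theorem sum_coloredGlue (hz : boundary 2 X z = 0) (h : H1 X →ₗ[ℤ] ℤ) {s : G.Dart}
    (hs : G.IsLeg s) (c : G.Dart → (ι →₀ ℤ)) :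
    ∑ l with G.IsLeg l ∧ l ≠ s, h (b.cls (c l)) • coloredGlue z b G s l c = 0 := by
  classical
  have hmem := glueSum_mem_closedBrane z hz b h (G.recolor c) ⟨s, hs⟩
  have h0 : QuotientAddGroup.mk' (closedBrane z b ⊔ openBrane z b)
      (glueSum (G.recolor c) ⟨s, hs⟩ fun i => h (loopClass (b.core i))) = 0 :=
    (QuotientAddGroup.eq_zero_iff _).mpr ((le_sup_left : closedBrane z b ≤ _) hmem)
  rw [glueSum, map_sum] at h0
  rw [← h0]
  symm
  refine Finset.sum_bij (ι := {l : (G.recolor c).Leg // l ≠ ⟨s, hs⟩}) (κ := G.Dart)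
    (fun l _ => l.1.1) (fun l _ => ?_) (fun l _ l' _ hl => ?_)
    (fun d hd => ?_) (fun l _ => ?_)
  · refine Finset.mem_filter.mpr ⟨Finset.mem_univ _, l.1.2, fun h => l.2 (Subtype.ext h)⟩
  · exact Subtype.ext (Subtype.ext hl)
  · obtain ⟨-, hl, hne⟩ := Finset.mem_filter.mp hd
    exact ⟨⟨⟨d, hl⟩, fun h => hne (congrArg Subtype.val h)⟩, Finset.mem_univ _, rfl⟩
  · rw [map_zsmul, linearCombination_loopClass]
    have : coloredGlue z b G s l.1.1 c =
        colored z b (G.join ⟨s, hs⟩ ⟨l.1.1, l.1.2⟩) c := dif_pos ⟨hs, l.1.2⟩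
    rw [this]
    rfl

/-- The graph obtained by cutting the edge containing `f`. -/
abbrev cut (G : UTGraph ι) (f : G.Dart) : UTGraph ι where
  n := G.n
  edge := Equiv.swap f (G.edge f) * G.edge
  edge_edge := fun d => by
    have h : G.edge * Equiv.swap f (G.edge f) = Equiv.swap f (G.edge f) * G.edge := by
      rw [Equiv.mul_swap_eq_swap_mul, G.edge_edge, Equiv.swap_comm]
    have h2 := congrArg (fun e : Equiv.Perm G.Dart => e (G.edge d)) h
    simp only [Equiv.Perm.mul_apply, G.edge_edge] at h2
    simp only [Equiv.Perm.mul_apply]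
    rw [← Equiv.Perm.mul_apply G.edge, h, Equiv.Perm.mul_apply, G.edge_edge,
      Equiv.swap_apply_self]
  color := G.color

theorem cut_edge_self (G : UTGraph ι) (f : G.Dart) : (G.cut f).edge f = f := by
  simp [Equiv.Perm.mul_apply]

theorem cut_edge_edge (G : UTGraph ι) (f : G.Dart) : (G.cut f).edge (G.edge f) = G.edge f := by
  simp [Equiv.Perm.mul_apply, G.edge_edge]

theorem cut_edge_of_ne {f d : G.Dart} (h : d ≠ f) (h' : d ≠ G.edge f) :
    (G.cut f).edge d = G.edge d := by
  rw [Equiv.Perm.mul_apply, Equiv.swap_apply_of_ne_of_ne]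
  · intro e
    exact h' (by rw [← e, G.edge_edge])
  · exact fun e => h (G.edge.injective e)

theorem isLeg_cut_iff {f d : G.Dart} :
    (G.cut f).IsLeg d ↔ G.IsLeg d ∨ d = f ∨ d = G.edge f := by
  by_cases h : d = f
  · subst h
    exact iff_of_true (G.cut_edge_self d) (Or.inr (Or.inl rfl))
  by_cases h' : d = G.edge f
  · subst h'
    exact iff_of_true (G.cut_edge_edge f) (Or.inr (Or.inr rfl))
  simp only [h, h', or_false]
  rw [IsLeg, cut_edge_of_ne h h', IsLeg]

theorem IsInternal.not_isLeg {f : G.Dart} (hf : G.IsInternal f) : ¬ G.IsLeg f := hf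

theorem IsInternal.not_isLeg_edge {f : G.Dart} (hf : G.IsInternal f) : ¬ G.IsLeg (G.edge f) :=
  fun h => hf (by rw [IsLeg, G.edge_edge] at h; exact h.symm)

theorem coloredGlue_cut_self {f : G.Dart} (c : G.Dart → (ι →₀ ℤ)) :
    coloredGlue z b (G.cut f) f (G.edge f) c = colored z b G c := by
  rw [coloredGlue, dif_pos ⟨G.cut_edge_self f, G.cut_edge_edge f⟩]
  have : ((G.cut f).join ⟨f, G.cut_edge_self f⟩ ⟨G.edge f, G.cut_edge_edge f⟩).recolor c =
      G.recolor c := by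
    simp only [join, recolor, UTGraph.mk.injEq, heq_eq_eq, true_and, and_true]
    rw [← mul_assoc, Equiv.swap_mul_self, one_mul]
  exact congrArg (toOpenBrane z b) this

/-- The closed brane relation at one half of an internal edge which is cut. -/
theorem smul_colored_add_sum_coloredGlue_cut (hz : boundary 2 X z = 0) (h : H1 X →ₗ[ℤ] ℤ)
    {f : G.Dart} (hf : G.IsInternal f) (c : G.Dart → (ι →₀ ℤ)) (u : ι →₀ ℤ) :
    h (b.cls u) • colored z b G c + ∑ l with G.IsLeg l, h (b.cls (c l)) •
      coloredGlue z b (G.cut f) f l (Function.update c (G.edge f) u) = 0 := by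
  have key := sum_coloredGlue (b := b) hz h (G := G.cut f) (G.cut_edge_self f)
    (Function.update c (G.edge f) u)
  -- The partners of `f` are the old legs and the other half of the cut edge; gluing to the latter
  -- restores `G`.
  have hs : (Finset.univ.filter fun l => (G.cut f).IsLeg l ∧ l ≠ f) =
      insert (G.edge f) (Finset.univ.filter fun l => G.IsLeg l) := by
    ext l
    simp only [Finset.mem_filter, Finset.mem_univ, true_and, Finset.mem_insert, isLeg_cut_iff]
    constructor
    · tauto
    · rintro (rfl | hl)
      · exact ⟨Or.inr (Or.inr rfl), hf⟩
      · exact ⟨Or.inl hl, fun e => hf (e ▸ hl)⟩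
  rw [hs, Finset.sum_insert (by simpa using hf.not_isLeg_edge)] at key
  rw [← key, coloredGlue_cut_self, Function.update_self]
  congr 1
  · congr 1
    refine colored_congr fun d hd => ?_
    rw [Function.update_of_ne]
    rintro rfl
    exact hf.not_isLeg_edge hd
  · refine Finset.sum_congr rfl fun l hl => ?_
    rw [Function.update_of_ne]
    rintro rfl
    exact hf.not_isLeg_edge (Finset.mem_filter.mp hl).2

/-- The new edge joins two half-edges at one vertex, so LOOP applies. -/
theorem coloredGlue_cut_eq_zero {f d : G.Dart} (hf : G.IsInternal f) (hd : G.IsLeg d)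
    (hv : f.1 = d.1) (c : G.Dart → (ι →₀ ℤ)) : coloredGlue z b (G.cut f) f d c = 0 := by
  rw [coloredGlue, dif_pos ⟨G.cut_edge_self f, isLeg_cut_iff.mpr (Or.inl hd)⟩]
  have hne : f ≠ d := fun e => hf (e ▸ hd)
  refine colored_eq_zero_of_loop (d := f) (d' := d) hv hne ?_
  change Equiv.swap f d ((G.cut f).edge f) = d
  rw [cut_edge_self, Equiv.swap_apply_left]

/-- A graph vanishes if a leg is adjacent to an internal edge and a surjective homomorphism
`H₁(X; ℤ) → ℤ` kills the colours of all the other legs. -/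
theorem colored_eq_zero_of_adjacent (hz : boundary 2 X z = 0) {f d : G.Dart}
    (hf : G.IsInternal f) (hd : G.IsLeg d) (hv : f.1 = d.1) {c : G.Dart → (ι →₀ ℤ)}
    {h : H1 X →ₗ[ℤ] ℤ} {u : ι →₀ ℤ} (hu : h (b.cls u) = 1)
    (hc : ∀ l, G.IsLeg l → l ≠ d → h (b.cls (c l)) = 0) : colored z b G c = 0 := by
  have key := smul_colored_add_sum_coloredGlue_cut (z := z) (b := b) hz h hf c u
  rw [Finset.sum_eq_zero fun l hl => ?_, hu, one_smul, add_zero] at key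
  · exact key
  · by_cases e : l = d
    · subst e
      rw [coloredGlue_cut_eq_zero hf hd hv, smul_zero]
    · rw [hc l (Finset.mem_filter.mp hl).2 e]
      exact zero_zsmul _

/-- If all half-edges at the vertex of `d` were legs, this vertex would be a whole component,
without internal edges. -/
theorem exists_internal_adjacent {d e : G.Dart} (he : G.IsInternal e)
    (hc : G.SameComponent d e) : ∃ f, G.IsInternal f ∧ f.1 = d.1 := by
  by_contra! hn
  have hleg : ∀ f : G.Dart, f.1 = d.1 → G.IsLeg f := fun f hf => by
    by_contra h
    exact hn f h hf
  have inv : ∀ a a' : G.Dart, Relation.EqvGen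
      (fun a a' : G.Dart => a.1 = a'.1 ∨ G.edge a = a') a a' → (a.1 = d.1 ↔ a'.1 = d.1) := by
    intro a a' h
    induction h with
    | rel a a' h =>
      rcases h with h | h
      · rw [h]
      · constructor
        · intro ha
          rw [← h, show G.edge a = a from hleg a ha, ha]
        · intro ha
          have h1 : G.edge a' = a' := hleg a' ha
          rw [← h, G.edge_edge, h] at h1
          rw [h1, ha]
    | refl a => rfl
    | symm a a' _ ih => exact ih.symm
    | trans a a' a'' _ _ ih ih' => exact ih.trans ih'
  exact he (hleg e ((inv d e hc).mp rfl))

/-- A graph with an internal edge and at most `r + 1` legs, at least one, vanishes if any `r`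
elements of `H₁(X; ℤ)` are killed by a surjective homomorphism to `ℤ`. -/
theorem colored_eq_zero_of_card_le (hz : boundary 2 X z = 0) {r : ℕ}
    (hr : ∀ C : Finset (H1 X), C.card ≤ r →
      ∃ (h : H1 X →ₗ[ℤ] ℤ) (u : ι →₀ ℤ), h (b.cls u) = 1 ∧ ∀ a ∈ C, h a = 0)
    {f d : G.Dart} (hf : G.IsInternal f) (hd : G.IsLeg d)
    (hcard : (Finset.univ.filter G.IsLeg).card ≤ r + 1) (c : G.Dart → (ι →₀ ℤ)) :
    colored z b G c = 0 := by
  classical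
  have kill : ∀ (D : Finset G.Dart) (c : G.Dart → (ι →₀ ℤ)), D.card ≤ r →
      ∃ (h : H1 X →ₗ[ℤ] ℤ) (u : ι →₀ ℤ), h (b.cls u) = 1 ∧ ∀ a ∈ D, h (b.cls (c a)) = 0 := by
    intro D c hD
    obtain ⟨h, u, hu, hk⟩ := hr (D.image fun a => b.cls (c a)) (Finset.card_image_le.trans hD)
    exact ⟨h, u, hu, fun a ha => hk _ (Finset.mem_image_of_mem _ ha)⟩
  have hd' : d ∈ Finset.univ.filter G.IsLeg := by simpa using hd
  obtain ⟨h, u, hu, hk⟩ := kill ((Finset.univ.filter G.IsLeg).erase d) c (by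
    rw [Finset.card_erase_of_mem hd']; omega)
  have hk' : ∀ l, G.IsLeg l → l ≠ d → h (b.cls (c l)) = 0 := fun l hl hne =>
    hk l (Finset.mem_erase.mpr ⟨hne, by simpa using hl⟩)
  by_cases hadj : ∃ e, G.IsInternal e ∧ e.1 = d.1
  · obtain ⟨e, he, hev⟩ := hadj
    exact colored_eq_zero_of_adjacent hz he hd hev hu hk'
  push Not at hadj
  have hleg : ∀ e : G.Dart, e.1 = d.1 → G.IsLeg e := fun e he => by
    by_contra h
    exact hadj e h he
  -- Now the component of `d` is one vertex with three legs; `d'` is another of them.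
  let d' : G.Dart := (d.1, d.2 + 1)
  have hd'leg : G.IsLeg d' := hleg d' rfl
  have hdd' : d' ≠ d := fun e => by
    have := congrArg Prod.snd e
    simp [d'] at this
  have hfd : f ≠ d := fun e => hf (e ▸ hd)
  have hfd' : f ≠ d' := fun e => hf (e ▸ hd'leg)
  have key := smul_colored_add_sum_coloredGlue_cut (z := z) (b := b) hz h hf c u
  rw [Finset.sum_eq_zero fun l hl => ?_, hu, one_smul, add_zero] at key
  · exact key
  by_cases e : l = d
  swap
  · rw [hk' l (Finset.mem_filter.mp hl).2 e]
    exact zero_zsmul _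
  subst e
  have hlcut : (G.cut f).IsLeg l := isLeg_cut_iff.mpr (Or.inl hd)
  have hglue : ∀ c, coloredGlue z b (G.cut f) f l c = 0 := by
    intro c'
    rw [coloredGlue, dif_pos ⟨G.cut_edge_self f, hlcut⟩]
    let J := (G.cut f).join ⟨f, G.cut_edge_self f⟩ ⟨l, hlcut⟩
    have hJ : ∀ a, J.edge a = Equiv.swap f l ((G.cut f).edge a) := fun a => rfl
    have hJl : J.edge l = f := (hJ l).trans (by
      rw [show (G.cut f).edge l = l from hlcut, Equiv.swap_apply_right])
    have hJf : J.edge f = l := (hJ f).trans (by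
      rw [cut_edge_self, Equiv.swap_apply_left])
    have hJleg : ∀ a : G.Dart, J.IsLeg a → a ≠ f ∧ a ≠ l ∧ (G.IsLeg a ∨ a = G.edge f) := by
      intro a ha
      have h1 : a ≠ f := fun e => by
        subst e
        exact hfd (hJf.symm.trans ha).symm
      have h2 : a ≠ l := fun e => by
        subst e
        exact hfd (hJl.symm.trans ha)
      refine ⟨h1, h2, ?_⟩
      have h3 : (G.cut f).IsLeg a := by
        have h4 : Equiv.swap f l ((G.cut f).edge a) = a := ha
        have h5 := congrArg (Equiv.swap f l) h4
        rw [Equiv.swap_apply_self, Equiv.swap_apply_of_ne_of_ne h1 h2] at h5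
        exact h5
      rcases isLeg_cut_iff.mp h3 with h | h | h
      · exact Or.inl h
      · exact absurd h h1
      · exact Or.inr h
    have hd'J : J.IsLeg d' := by
      change Equiv.swap f l ((G.cut f).edge d') = d'
      rw [show (G.cut f).edge d' = d' from isLeg_cut_iff.mpr (Or.inl hd'leg),
        Equiv.swap_apply_of_ne_of_ne hfd'.symm hdd']
    -- In `J` the glued edge is internal and adjacent to `d'`. The other legs are `G.edge f` and the
    -- old legs except `l` and `d'`, hence at most `(r + 1) - 2 + 1 = r` of them, and a second
    -- functional kills their colours.
    obtain ⟨h', u', hu', hk''⟩ := kill (insert (G.edge f)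
      (((Finset.univ.filter G.IsLeg).erase l).erase d')) c' (by
        refine (Finset.card_insert_le _ _).trans ?_
        rw [Finset.card_erase_of_mem (Finset.mem_erase.mpr ⟨hdd', by simpa using hd'leg⟩),
          Finset.card_erase_of_mem hd']
        have : 1 < (Finset.univ.filter G.IsLeg).card :=
          Finset.one_lt_card.mpr ⟨d', by simpa using hd'leg, l, hd', hdd'⟩
        omega)
    refine colored_eq_zero_of_adjacent (G := J) hz (f := l) (d := d')
      (fun e => hfd (hJl.symm.trans e)) hd'J rfl hu'
      fun (a : G.Dart) ha hne => hk'' a ?_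
    obtain ⟨-, h2, h3⟩ := hJleg a ha
    rcases h3 with h3 | h3
    · exact Finset.mem_insert_of_mem (Finset.mem_erase.mpr
        ⟨hne, Finset.mem_erase.mpr ⟨h2, by simpa using h3⟩⟩)
    · exact h3 ▸ Finset.mem_insert_self _ _
  rw [hglue, smul_zero]

end BraneGraph.UTGraph

/-! ### Integral functionals on a finitely generated abelian group -/

section Homs

variable {A : Type*} [AddCommGroup A]

theorem exists_projection_of_free_quotient {Q : Type*} [AddCommGroup Q] [Module.Free ℤ Q]
    (π : A →ₗ[ℤ] Q) (hπ : Function.Surjective π) :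
    ∃ p : A →ₗ[ℤ] A, (∀ a, π (p a) = 0) ∧ ∀ a, π a = 0 → p a = a := by
  obtain ⟨s, hs⟩ := Module.projective_lifting_property π LinearMap.id hπ
  have hs' : ∀ q, π (s q) = q := fun q => LinearMap.congr_fun hs q
  exact ⟨LinearMap.id - s ∘ₗ π, fun a => by simp [hs'], fun a ha => by simp [ha]⟩

/-- A nonzero integral functional is a multiple of a surjective one. -/
theorem exists_eq_mul_surjective (g : A →ₗ[ℤ] ℤ) (hg : g ≠ 0) :
    ∃ (m : ℤ) (l : A →ₗ[ℤ] ℤ), m ≠ 0 ∧ (∀ a, g a = m * l a) ∧ ∃ a, l a = 1 := by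
  obtain ⟨m, hm⟩ := (IsPrincipalIdealRing.principal (LinearMap.range g)).principal
  have hdvd : ∀ a, m ∣ g a := fun a => by
    have : g a ∈ LinearMap.range g := ⟨a, rfl⟩
    rw [hm, Submodule.mem_span_singleton] at this
    obtain ⟨k, hk⟩ := this
    exact ⟨k, by rw [← hk, smul_eq_mul, mul_comm]⟩
  have hm0 : m ≠ 0 := by
    rintro rfl
    exact hg (LinearMap.ext fun a => zero_dvd_iff.mp (hdvd a))
  choose l hl using hdvd
  refine ⟨m, { toFun := l, map_add' := fun a a' => ?_, map_smul' := fun k a => ?_ }, hm0, hl, ?_⟩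
  · apply mul_left_cancel₀ hm0
    rw [mul_add, ← hl, ← hl, ← hl, map_add]
  · apply mul_left_cancel₀ hm0
    rw [← hl, map_smul, hl a, smul_eq_mul, smul_eq_mul, RingHom.id_apply]
    ring
  · have : m ∈ LinearMap.range g := hm ▸ Submodule.mem_span_singleton_self m
    obtain ⟨a, ha⟩ := this
    refine ⟨a, mul_left_cancel₀ hm0 ?_⟩
    change m * l a = m * 1
    rw [← hl, ha, mul_one]

variable [Module.Finite ℤ A]

/-- The saturation of a subgroup is the kernel of a map onto a free group of finite rank. -/
theorem exists_free_quotient_saturation (Y : Submodule ℤ A) :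
    ∃ (n : ℕ) (π : A →ₗ[ℤ] (Fin n → ℤ)), Function.Surjective π ∧
      ∀ a, π a = 0 ↔ ∃ m : ℤ, m ≠ 0 ∧ m • a ∈ Y := by
  let T := Submodule.torsion ℤ (A ⧸ Y)
  let e := (Module.finBasis ℤ ((A ⧸ Y) ⧸ T)).equivFun
  refine ⟨_, e.toLinearMap ∘ₗ T.mkQ ∘ₗ Y.mkQ, ?_, fun a => ?_⟩
  · exact e.surjective.comp ((Submodule.mkQ_surjective _).comp (Submodule.mkQ_surjective _))
  · simp only [LinearMap.comp_apply, LinearEquiv.coe_coe, EmbeddingLike.map_eq_zero_iff,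
      Submodule.mkQ_apply, Submodule.Quotient.mk_eq_zero]
    rw [Submodule.mem_torsion_iff]
    constructor
    · rintro ⟨m, hm⟩
      refine ⟨m, nonZeroDivisors.ne_zero m.2, ?_⟩
      rwa [Submonoid.smul_def, ← Submodule.Quotient.mk_smul, Submodule.Quotient.mk_eq_zero] at hm
    · rintro ⟨m, hm, h⟩
      refine ⟨⟨m, mem_nonZeroDivisors_of_ne_zero hm⟩, ?_⟩
      rwa [Submonoid.smul_def, ← Submodule.Quotient.mk_smul, Submodule.Quotient.mk_eq_zero]

/-- The quotient by the saturation of `Y` is free, and nonzero because of `x`; any coordinate of it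
will do. -/
theorem exists_surjective_hom_vanishing (Y : Submodule ℤ A) {x : A}
    (hx : ∀ m : ℤ, m • x ∈ Y → m = 0) :
    ∃ h : A →ₗ[ℤ] ℤ, Function.Surjective h ∧
      ∀ a, (∃ m : ℤ, m ≠ 0 ∧ m • a ∈ Y) → h a = 0 := by
  obtain ⟨n, π, hπ, hker⟩ := exists_free_quotient_saturation Y
  have hne : π x ≠ 0 := fun h => by
    obtain ⟨m, hm, hmx⟩ := (hker x).mp h
    exact hm (hx m hmx)
  obtain ⟨i, -⟩ := Function.ne_iff.mp hne
  refine ⟨LinearMap.proj i ∘ₗ π, fun k => ?_, fun a ha => ?_⟩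
  · obtain ⟨a, ha⟩ := hπ fun _ => k
    exact ⟨a, by simp [ha]⟩
  · simp [(hker a).mpr ha]

theorem exists_surjective_hom_of_card_lt_finrank {r : ℕ} (hr : r < Module.finrank ℤ A)
    (C : Finset A) (hC : C.card ≤ r) :
    ∃ h : A →ₗ[ℤ] ℤ, Function.Surjective h ∧ ∀ a ∈ C, h a = 0 := by
  let Y := Submodule.span ℤ (C : Set A)
  have hY : Module.finrank ℤ Y ≤ r := (finrank_span_finset_le_card C).trans hC
  -- Otherwise `A ⧸ Y` is torsion, and additivity of rank contradicts `r < finrank A`.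
  have hex : ∃ x : A, ∀ m : ℤ, m • x ∈ Y → m = 0 := by
    by_contra! hall
    have htors : Module.IsTorsion ℤ (A ⧸ Y) := by
      intro q
      obtain ⟨a, rfl⟩ := Submodule.mkQ_surjective Y q
      obtain ⟨m, hm, hm0⟩ := hall a
      refine ⟨⟨m, mem_nonZeroDivisors_of_ne_zero hm0⟩, ?_⟩
      rwa [Submonoid.smul_def, Submodule.mkQ_apply, ← Submodule.Quotient.mk_smul,
        Submodule.Quotient.mk_eq_zero]
    have h0 : Module.finrank ℤ (A ⧸ Y) = 0 := Module.finrank_eq_zero_iff_isTorsion.mpr htors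
    have := Submodule.finrank_quotient_add_finrank Y
    omega
  obtain ⟨x, hx⟩ := hex
  obtain ⟨h, hs, hk⟩ := exists_surjective_hom_vanishing Y hx
  exact ⟨h, hs, fun a ha => hk a ⟨1, one_ne_zero, by
    rw [one_smul]; exact Submodule.subset_span ha⟩⟩

theorem exists_smul_mem_of_forall_exists_smul_mem (E Y : Submodule ℤ A)
    (h : ∀ a ∈ E, ∃ m : ℤ, m ≠ 0 ∧ m • a ∈ Y) :
    ∃ N : ℤ, N ≠ 0 ∧ ∀ a ∈ E, N • a ∈ Y := by
  obtain ⟨S, hS⟩ := (IsNoetherian.noetherian E : E.FG)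
  have hSE : ∀ a ∈ S, a ∈ E := fun a ha => hS ▸ Submodule.subset_span ha
  choose! m hm hmY using h
  refine ⟨∏ a ∈ S, m a, Finset.prod_ne_zero_iff.mpr fun a ha => hm a (hSE a ha), ?_⟩
  have : E ≤ Y.comap (LinearMap.lsmul ℤ A (∏ a ∈ S, m a)) := by
    rw [← hS, Submodule.span_le]
    intro a ha
    obtain ⟨k, hk⟩ := Finset.dvd_prod_of_mem m ha
    simp only [SetLike.mem_coe, Submodule.mem_comap, LinearMap.lsmul_apply, hk]
    rw [mul_comm, mul_smul]
    exact Y.smul_mem _ (hmY a (hSE a ha))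
  exact fun a ha => this ha

/-- The sum of coordinates takes the value `1` on each `y i`, but is defined only on their span. A
multiple extends to `A`, and dividing by the generator of its image makes it surjective while it
stays constant on the `y i`. The element `e` is sought in the saturation, since the span itself need
not contain an element of value `1`. -/
theorem exists_hom_constant_on_independent {r : ℕ} (y : Fin (r + 1) → A)
    (hy : LinearIndepOn ℤ id (Set.range y)) :
    ∃ (d : ℤ) (e : A) (l : A →ₗ[ℤ] ℤ), l e = 1 ∧ (∀ i, l (y i) = d) ∧
      ∃ m : ℤ, m ≠ 0 ∧ m • e ∈ Submodule.span ℤ (Set.range y) := by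
  set Y := Submodule.span ℤ (Set.range y) with hYdef
  have hYr : Submodule.span ℤ (Set.range fun s : Set.range y => id s.1) = Y := by
    rw [hYdef]
    congr 1
    exact Subtype.range_coe
  let f : Y →ₗ[ℤ] ℤ := Finsupp.linearCombination ℤ (fun _ => (1 : ℤ)) ∘ₗ
    hy.repr ∘ₗ (LinearEquiv.ofEq _ _ hYr.symm).toLinearMap
  have hyY : ∀ i, y i ∈ Y := fun i => Submodule.subset_span ⟨i, rfl⟩
  have hf : ∀ i, f ⟨y i, hyY i⟩ = 1 := fun i => by
    have := hy.repr_eq_single ⟨y i, i, rfl⟩ ⟨y i, hYr ▸ hyY i⟩ rfl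
    simp only [f, LinearMap.comp_apply]
    erw [this]
    simp
  obtain ⟨n, π, hπ, hker⟩ := exists_free_quotient_saturation Y
  obtain ⟨p, hp, hpE⟩ := exists_projection_of_free_quotient π hπ
  obtain ⟨N, hN, hNY⟩ := exists_smul_mem_of_forall_exists_smul_mem (LinearMap.ker π) Y
    fun a ha => (hker a).mp ha
  -- `p` projects `A` onto the saturation and `N` carries the saturation into `Y`, where `f` is
  -- defined.
  let g : A →ₗ[ℤ] ℤ := f ∘ₗ LinearMap.codRestrict Y (N • p) fun a => hNY _ (hp a)
  have hyE : ∀ i, π (y i) = 0 := fun i => (hker _).mpr ⟨1, one_ne_zero, by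
    rw [one_smul]; exact hyY i⟩
  have hgy : ∀ i, g (y i) = N := fun i => by
    have : LinearMap.codRestrict Y (N • p) (fun a => hNY _ (hp a)) (y i) = N • ⟨y i, hyY i⟩ := by
      ext1
      simp [hpE _ (hyE i)]
    simp only [g, LinearMap.comp_apply]
    rw [this, map_smul, hf, smul_eq_mul, mul_one]
  have hg0 : g ≠ 0 := fun h => hN (by rw [← hgy 0, h, LinearMap.zero_apply])
  obtain ⟨m, l, hm, hl, a, ha⟩ := exists_eq_mul_surjective g hg0
  -- Since `g` factors through the idempotent `p`, the element `a` of value `1` can be moved into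
  -- the saturation.
  refine ⟨l (y 0), p a, l, ?_, fun i => ?_, (hker _).mp (hp a)⟩
  · apply mul_left_cancel₀ hm
    rw [← ha, ← hl, ← hl]
    have : LinearMap.codRestrict Y (N • p) (fun a => hNY _ (hp a)) (p a) =
        LinearMap.codRestrict Y (N • p) (fun a => hNY _ (hp a)) a := by
      ext1
      simp [hpE _ (hp a)]
    simp only [g, LinearMap.comp_apply, this]
  · apply mul_left_cancel₀ hm
    rw [← hl, ← hl, hgy, hgy]

theorem finrank_gt_of_linearIndependent {r : ℕ} {y : Fin r → A} (hy : LinearIndependent ℤ y)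
    {x : A} (hx : ∀ m : ℤ, m • x ∈ Submodule.span ℤ (Set.range y) → m = 0) :
    r < Module.finrank ℤ A := by
  have hli : LinearIndependent ℤ (Fin.cons x y : Fin (r + 1) → A) :=
    LinearIndependent.finCons' x y hy fun c v hv h => hx c (by
      rw [eq_neg_of_add_eq_zero_left h]
      exact neg_mem hv)
  simpa using hli.fintype_card_le_finrank

end Homs

/-! ### Algebra of replacing colours -/

section Replacement

variable {V B : Type*} [AddCommGroup B] {r : ℕ}

/-- Pairs of a set and one of its elements correspond to pairs of a smaller set and an element
outside it. -/
theorem sum_powersetCard_succ_sum (k : ℕ) (φ : Finset (Fin r) → Fin r → B) :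
    ∑ S ∈ Finset.powersetCard (k + 1) Finset.univ, ∑ i ∈ S, φ S i =
      ∑ S ∈ Finset.powersetCard k Finset.univ, ∑ i ∈ Sᶜ, φ (insert i S) i := by
  rw [Finset.sum_sigma', Finset.sum_sigma']
  refine Finset.sum_nbij' (fun a => ⟨a.1.erase a.2, a.2⟩) (fun a => ⟨insert a.2 a.1, a.2⟩)
    ?_ ?_ ?_ ?_ ?_
  · rintro ⟨S, i⟩ h
    simp only [Finset.mem_sigma, Finset.mem_powersetCard_univ, Finset.mem_compl] at h ⊢
    exact ⟨by rw [Finset.card_erase_of_mem h.2]; omega, Finset.notMem_erase i S⟩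
  · rintro ⟨S, i⟩ h
    simp only [Finset.mem_sigma, Finset.mem_powersetCard_univ, Finset.mem_compl] at h ⊢
    exact ⟨by rw [Finset.card_insert_of_notMem h.2, h.1], Finset.mem_insert_self i S⟩
  · rintro ⟨S, i⟩ h
    simp only [Finset.mem_sigma] at h
    simp [Finset.insert_erase h.2]
  · rintro ⟨S, i⟩ h
    simp only [Finset.mem_sigma, Finset.mem_compl] at h
    simp [Finset.erase_insert h.2]
  · rintro ⟨S, i⟩ h
    simp only [Finset.mem_sigma] at h
    simp [Finset.insert_erase h.2]

/-- If `h₀` kills the colours `c` and `h₁` kills `x`, and `h₁` is on `c` proportional to the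
weights `w`, then the brane relations given by `h₀` and `h₁` imply that the weighted sums over
all ways of replacing `k` of the colours `c` by `x` vanish. -/
theorem sum_weighted_replace_eq_zero (F₀ : (Fin r → V) → B) (F : Fin r → (Fin r → V) → V → B)
    (hF : ∀ i c v u, F i (Function.update c i v) u = F i c u) (h₀ h₁ : V → ℤ)
    (rel₀ : ∀ c u, h₀ u • F₀ c + ∑ i, h₀ (c i) • F i c u = 0)
    (rel₁ : ∀ c u, h₁ u • F₀ c + ∑ i, h₁ (c i) • F i c u = 0)
    {x u : V} {c : Fin r → V} {w : Fin r → ℤ} (hu : h₀ u = 1) (hc₀ : ∀ i, h₀ (c i) = 0)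
    (hx : h₁ x = 0) (hc₁ : ∀ i, h₁ (c i) = h₀ x * w i) (k : ℕ) :
    ∑ S ∈ Finset.powersetCard k Finset.univ,
      (∏ i ∈ S, w i) • F₀ (S.piecewise (fun _ => x) c) = 0 := by
  induction k with
  | zero => simpa [hu, hc₀] using rel₀ c u
  | succ k ih =>
    have hsum : ∀ (φ : Fin r → B) (T : Finset (Fin r)),
        (∀ i, i ∉ T → φ i = 0) → ∑ i, φ i = ∑ i ∈ T, φ i := fun φ T h =>
      (Finset.sum_subset (Finset.subset_univ T) fun i _ hi => h i hi).symm
    -- `h₀` sees only the replaced slots, and `h₁` below only the others.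
    have e₀ : ∀ S : Finset (Fin r), F₀ (S.piecewise (fun _ => x) c) =
        -∑ i ∈ S, h₀ x • F i (S.piecewise (fun _ => x) c) u := fun S => by
      have := rel₀ (S.piecewise (fun _ => x) c) u
      rw [hu, one_smul, hsum _ S fun i hi => by
        rw [Finset.piecewise_eq_of_notMem _ _ _ hi, hc₀, zero_smul]] at this
      rw [eq_neg_of_add_eq_zero_left this]
      congr 1
      exact Finset.sum_congr rfl fun i hi => by rw [Finset.piecewise_eq_of_mem _ _ _ hi]
    have e₁ : ∀ S : Finset (Fin r),
        ∑ i ∈ Sᶜ, (h₀ x * w i) • F i (S.piecewise (fun _ => x) c) u =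
          -(h₁ u • F₀ (S.piecewise (fun _ => x) c)) := fun S => by
      have := rel₁ (S.piecewise (fun _ => x) c) u
      rw [hsum _ Sᶜ fun i hi => by
        rw [Finset.piecewise_eq_of_mem _ _ _ (by simpa using hi), hx, zero_smul]] at this
      rw [← eq_neg_of_add_eq_zero_right this]
      refine Finset.sum_congr rfl fun i hi => ?_
      rw [Finset.piecewise_eq_of_notMem _ _ _ (by simpa using hi), hc₁]
    calc ∑ S ∈ Finset.powersetCard (k + 1) Finset.univ,
          (∏ i ∈ S, w i) • F₀ (S.piecewise (fun _ => x) c)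
        = -∑ S ∈ Finset.powersetCard (k + 1) Finset.univ, ∑ i ∈ S,
            ((∏ j ∈ S, w j) * h₀ x) • F i (S.piecewise (fun _ => x) c) u := by
          rw [← Finset.sum_neg_distrib]
          refine Finset.sum_congr rfl fun S _ => ?_
          rw [e₀, smul_neg, Finset.smul_sum]
          simp only [mul_smul]
      -- As `F i` ignores the colour in slot `i`, that slot can be un-replaced: the terms become
      -- those of `e₁` for sets of size `k`.
      _ = -∑ S ∈ Finset.powersetCard k Finset.univ, (∏ j ∈ S, w j) •
            ∑ i ∈ Sᶜ, (h₀ x * w i) • F i (S.piecewise (fun _ => x) c) u := by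
          rw [sum_powersetCard_succ_sum]
          congr 1
          refine Finset.sum_congr rfl fun S _ => ?_
          rw [Finset.smul_sum]
          refine Finset.sum_congr rfl fun i hi => ?_
          rw [Finset.piecewise_insert, hF, Finset.prod_insert (by simpa using hi), smul_smul]
          congr 1
          ring
      _ = h₁ u • ∑ S ∈ Finset.powersetCard k Finset.univ,
            (∏ i ∈ S, w i) • F₀ (S.piecewise (fun _ => x) c) := by
          rw [← Finset.sum_neg_distrib, Finset.smul_sum]
          refine Finset.sum_congr rfl fun S _ => ?_
          rw [e₁, smul_neg, neg_neg, smul_comm]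
      _ = 0 := by rw [ih, smul_zero]

/-- Expand each `v i + d • e`, with `T` the set of slots where `v i` is chosen. The weight `0` on
`T` discards the sets `S` meeting `T`, since replaced slots are not expanded. -/
theorem sum_replace_eq_zero_of_expansion [AddCommGroup V]
    (f : MultilinearMap ℤ (fun _ : Fin r => V) B) (x e : V)
    (d : ℤ) (v : Fin r → V) (k : ℕ)
    (H : ∀ T : Finset (Fin r), ∑ S ∈ Finset.powersetCard k Finset.univ,
      (∏ i ∈ S, if i ∈ T then (0 : ℤ) else 1) •
        f (S.piecewise (fun _ => x) (T.piecewise v fun _ => e)) = 0) :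
    ∑ S ∈ Finset.powersetCard k Finset.univ,
      f (S.piecewise (fun _ => x) fun i => v i + d • e) = 0 := by
  have hexp : ∀ S ∈ Finset.powersetCard k (Finset.univ : Finset (Fin r)),
      f (S.piecewise (fun _ => x) fun i => v i + d • e) =
      ∑ T : Finset (Fin r), d ^ (r - k - T.card) • ((∏ i ∈ S, if i ∈ T then (0 : ℤ) else 1) •
        f (S.piecewise (fun _ => x) (T.piecewise v fun _ => e))) := by
    intro S hS
    -- A replaced slot is split as `0 + x`, so choosing the first summand there kills the term.
    have hsplit : (S.piecewise (fun _ => x) fun i => v i + d • e) =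
        S.piecewise (fun _ => 0) v + S.piecewise (fun _ => x) fun _ => d • e := by
      ext1 i
      by_cases hi : i ∈ S <;> simp [hi]
    rw [hsplit, MultilinearMap.map_add_univ]
    refine Finset.sum_congr rfl fun T _ => ?_
    have hsm : T.piecewise (S.piecewise (fun _ => 0) v) (S.piecewise (fun _ => x) fun _ => d • e) =
        fun i => (if i ∈ S then (if i ∈ T then (0 : ℤ) else 1) else (if i ∈ T then 1 else d)) •
          S.piecewise (fun _ => x) (T.piecewise v fun _ => e) i := by
      ext1 i
      by_cases hi : i ∈ S <;> by_cases hT : i ∈ T <;> simp [hi, hT]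
    rw [hsm, MultilinearMap.map_smul_univ, smul_smul]
    congr 1
    rw [← Finset.prod_mul_prod_compl S, Finset.prod_congr rfl fun i hi => if_pos hi,
      Finset.prod_congr (s₁ := Sᶜ) rfl fun i hi => if_neg (by simpa using hi), mul_comm]
    -- For disjoint `S` and `T`, exactly `r - k - |T|` slots carry `d • e`; otherwise both sides
    -- contain a factor `0`.
    by_cases hd : Disjoint S T
    · congr 1
      rw [Finset.prod_ite, Finset.prod_const_one, one_mul, Finset.prod_const]
      congr 1
      have : (Sᶜ.filter fun i => i ∉ T) = (S ∪ T)ᶜ := by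
        ext i
        simp
      rw [this, Finset.card_compl, Finset.card_union_of_disjoint hd, Fintype.card_fin,
        (Finset.mem_powersetCard_univ.mp hS), Nat.sub_sub]
    · obtain ⟨i, hi, hiT⟩ := Finset.not_disjoint_iff.mp hd
      rw [Finset.prod_eq_zero (s := S) hi (by simp [hiT]), mul_zero, mul_zero]
  rw [Finset.sum_congr rfl hexp, Finset.sum_comm]
  refine Finset.sum_eq_zero fun T _ => ?_
  rw [← Finset.smul_sum, H, smul_zero]

end Replacement

/-! ### Graphs as multilinear functions of their numbered legs -/

namespace BraneGraph.UTGraph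

variable {ι : Type*} {X : Type*} [TopologicalSpace X] {z : Chain 3 X} {b : FramedLink ι X}
variable {G : UTGraph ι} {r : ℕ}

/-- The colouring of the legs by `x` and `c`. -/
noncomputable def legColors (leg : Fin (r + 1) ≃ G.Leg) (x : ι →₀ ℤ) (c : Fin r → (ι →₀ ℤ)) :
    G.Dart → (ι →₀ ℤ) := fun d =>
  -- The default `0` never matters: after cutting and gluing `f`, the only new leg `G.edge f` gets
  -- the colour `u`.
  if h : G.IsLeg d then (Fin.cons x c : Fin (r + 1) → (ι →₀ ℤ)) (leg.symm ⟨d, h⟩) else 0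

theorem legColors_zero (leg : Fin (r + 1) ≃ G.Leg) (x : ι →₀ ℤ) (c : Fin r → (ι →₀ ℤ)) :
    legColors leg x c (leg 0).1 = x := by
  simp [legColors, (leg 0).2]

theorem legColors_succ (leg : Fin (r + 1) ≃ G.Leg) (x : ι →₀ ℤ) (c : Fin r → (ι →₀ ℤ))
    (i : Fin r) : legColors leg x c (leg i.succ).1 = c i := by
  simp [legColors, (leg i.succ).2]

theorem forall_isLeg_iff (leg : Fin (r + 1) ≃ G.Leg) {p : G.Dart → Prop} :
    (∀ d, G.IsLeg d → p d) ↔ p (leg 0).1 ∧ ∀ i : Fin r, p (leg i.succ).1 := by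
  constructor
  · exact fun h => ⟨h _ (leg 0).2, fun i => h _ (leg i.succ).2⟩
  · rintro ⟨h0, hs⟩ d hd
    obtain ⟨j, hj⟩ := leg.surjective ⟨d, hd⟩
    obtain rfl : (leg j).1 = d := congrArg Subtype.val hj
    induction j using Fin.cases with
    | zero => exact h0
    | succ i => exact hs i

theorem leg_succ_ne (leg : Fin (r + 1) ≃ G.Leg) {i j : Fin (r + 1)} (h : i ≠ j) :
    (leg i).1 ≠ (leg j).1 := fun e => h (leg.injective (Subtype.ext e))

theorem legColors_update (leg : Fin (r + 1) ≃ G.Leg) (x : ι →₀ ℤ) (c : Fin r → (ι →₀ ℤ))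
    (i : Fin r) (v : ι →₀ ℤ) {d : G.Dart} (hd : G.IsLeg d) :
    legColors leg x (Function.update c i v) d =
      Function.update (legColors leg x c) (leg i.succ).1 v d := by
  revert d
  rw [forall_isLeg_iff leg]
  refine ⟨?_, fun j => ?_⟩
  · rw [legColors_zero, Function.update_of_ne (leg_succ_ne leg (Fin.succ_ne_zero i).symm),
      legColors_zero]
  · rw [legColors_succ]
    by_cases h : j = i
    · subst h
      simp
    · rw [Function.update_of_ne h, Function.update_of_ne
        (leg_succ_ne leg fun e => h (Fin.succ_injective _ e)), legColors_succ]

theorem sum_isLeg {B : Type*} [AddCommMonoid B] (leg : Fin (r + 1) ≃ G.Leg) (φ : G.Dart → B) :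
    ∑ l with G.IsLeg l, φ l = φ (leg 0).1 + ∑ i : Fin r, φ (leg i.succ).1 := by
  rw [← Fin.sum_univ_succ fun i => φ (leg i).1]
  symm
  refine Finset.sum_bij (fun i _ => (leg i).1) (fun i _ => ?_) (fun i _ j _ h => ?_)
    (fun d hd => ?_) fun i _ => rfl
  · simpa using (leg i).2
  · exact leg.injective (Subtype.ext h)
  · obtain ⟨j, hj⟩ := leg.surjective ⟨d, (Finset.mem_filter.mp hd).2⟩
    exact ⟨j, Finset.mem_univ _, congrArg Subtype.val hj⟩

theorem card_isLeg (leg : Fin (r + 1) ≃ G.Leg) : (Finset.univ.filter G.IsLeg).card = r + 1 := by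
  rw [← Fintype.card_subtype, ← Fintype.card_congr leg, Fintype.card_fin]

theorem colored_update_zsmul {d : G.Dart} (hd : G.IsLeg d) (c : G.Dart → (ι →₀ ℤ)) (n : ℤ)
    (a : ι →₀ ℤ) : colored z b G (Function.update c d (n • a)) =
      n • colored z b G (Function.update c d a) :=
  map_zsmul (AddMonoidHom.mk' (fun a => colored z b G (Function.update c d a))
    fun a a' => colored_update_add hd c a a') n a

theorem colored_legColors_update (leg : Fin (r + 1) ≃ G.Leg) (x : ι →₀ ℤ)
    (c : Fin r → (ι →₀ ℤ)) (i : Fin r) (v : ι →₀ ℤ) :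
    colored z b G (legColors leg x (Function.update c i v)) =
      colored z b G (Function.update (legColors leg x c) (leg i.succ).1 v) :=
  colored_congr fun _ hd => legColors_update leg x c i v hd

/-- The class of a graph as a multilinear function of the colours of the legs `1, …, r`. -/
noncomputable def coloredMultilinear (z : Chain 3 X) (b : FramedLink ι X)
    (leg : Fin (r + 1) ≃ G.Leg) (x : ι →₀ ℤ) :
    MultilinearMap ℤ (fun _ : Fin r => ι →₀ ℤ) (OpenBraneGroup z b) :=
  MultilinearMap.mk' (fun c => colored z b G (legColors leg x c))
    (fun c i a a' => by
      simp only [colored_legColors_update]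
      exact colored_update_add (leg i.succ).2 _ a a')
    (fun c i n a => by
      simp only [colored_legColors_update]
      exact colored_update_zsmul (leg i.succ).2 _ n a)

/-- Once glued, `l` is no longer a leg. This is the independence `hF` required by
`sum_weighted_replace_eq_zero`. -/
theorem coloredGlue_congr {s l : G.Dart} (hsl : s ≠ l) {c c' : G.Dart → (ι →₀ ℤ)}
    (h : ∀ d, d ≠ l → c d = c' d) : coloredGlue z b G s l c = coloredGlue z b G s l c' := by
  by_cases hl : G.IsLeg s ∧ G.IsLeg l
  · rw [coloredGlue, dif_pos hl, coloredGlue, dif_pos hl]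
    refine colored_congr fun (d : G.Dart) hd => h d ?_
    rintro rfl
    have h1 : Equiv.swap s d (G.edge d) = d := hd
    rw [show G.edge d = d from hl.2, Equiv.swap_apply_right] at h1
    exact hsl h1
  · rw [coloredGlue, dif_neg hl, coloredGlue, dif_neg hl]

/-- Replacing colours in terms of the multilinear function of the colours. -/
theorem replace_toOpenBrane (leg : Fin (r + 1) ≃ G.Leg) (S : Finset (Fin r)) :
    (G.replace leg S).toOpenBrane z b = coloredMultilinear z b leg (G.color (leg 0).1)
      (S.piecewise (fun _ => G.color (leg 0).1) fun i => G.color (leg i.succ).1) := by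
  classical
  refine colored_congr ?_
  rw [forall_isLeg_iff leg]
  refine ⟨?_, fun i => ?_⟩
  · rw [legColors_zero, ite_self]
  · rw [legColors_succ]
    have : (∃ j ∈ S, (leg j.succ).1 = (leg i.succ).1) ↔ i ∈ S := by
      constructor
      · rintro ⟨j, hj, h⟩
        obtain rfl : j = i := by
          by_contra hne
          exact leg_succ_ne leg (fun e => hne (Fin.succ_injective _ e)) h
        exact hj
      · exact fun hi => ⟨i, hi, rfl⟩
    by_cases hi : i ∈ S
    · rw [if_pos (this.mpr hi), Finset.piecewise_eq_of_mem _ _ _ hi]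
    · rw [if_neg (this.not.mpr hi), Finset.piecewise_eq_of_notMem _ _ _ hi]

theorem smul_coloredMultilinear_add_sum (hz : boundary 2 X z = 0) (leg : Fin (r + 1) ≃ G.Leg)
    {f : G.Dart} (hf : G.IsInternal f) (hv : f.1 = (leg 0).1.1) (x : ι →₀ ℤ) (h : H1 X →ₗ[ℤ] ℤ)
    (c : Fin r → (ι →₀ ℤ)) (u : ι →₀ ℤ) :
    h (b.cls u) • coloredMultilinear z b leg x c + ∑ i : Fin r, h (b.cls (c i)) •
      coloredGlue z b (G.cut f) f (leg i.succ).1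
        (Function.update (legColors (G := G) leg x c) (G.edge f) u) = 0 := by
  have key := smul_colored_add_sum_coloredGlue_cut (z := z) (b := b) hz h hf (legColors leg x c) u
  rw [sum_isLeg leg, coloredGlue_cut_eq_zero hf (leg 0).2 hv, smul_zero] at key
  simp only [legColors_succ] at key
  rw [← key]
  exact congrArg _ (zero_add _).symm

/-- If the leg `0` is adjacent to an internal edge, then the sum over all ways of replacing `k` of
the colours `v i + d • e` by the colour `x` of the leg `0` vanishes, provided that a functional
`l` takes the value `1` at `e` and kills `v i`, and that a surjective functional kills them all. -/
theorem sum_replace_eq_zero (hz : boundary 2 X z = 0) (leg : Fin (r + 1) ≃ G.Leg)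
    {f : G.Dart} (hf : G.IsInternal f) (hv : f.1 = (leg 0).1.1) (x e u : ι →₀ ℤ) (d : ℤ)
    (v : Fin r → (ι →₀ ℤ)) (h l : H1 X →ₗ[ℤ] ℤ) (hu : h (b.cls u) = 1) (he : h (b.cls e) = 0)
    (hvi : ∀ i, h (b.cls (v i)) = 0) (hle : l (b.cls e) = 1) (hlv : ∀ i, l (b.cls (v i)) = 0)
    (k : ℕ) :
    ∑ S ∈ Finset.powersetCard k Finset.univ,
      coloredMultilinear z b leg x (S.piecewise (fun _ => x) fun i => v i + d • e) = 0 := by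
  refine sum_replace_eq_zero_of_expansion _ x e d v k fun T => ?_
  refine sum_weighted_replace_eq_zero (coloredMultilinear z b leg x)
    (fun i c u => coloredGlue z b (G.cut f) f (leg i.succ).1
      (Function.update (legColors (G := G) leg x c) (G.edge f) u)) (fun i c v u => ?_)
    (fun a => h (b.cls a))
    -- This combination vanishes on `x`, and on the other colours, which `h` kills, it equals `h(x)
    -- l`: thus `h(x)` on `e` and `0` on `v i`.
    (fun a => (h (b.cls x) • l - l (b.cls x) • h : H1 X →ₗ[ℤ] ℤ) (b.cls a))
    (fun c u => smul_coloredMultilinear_add_sum hz leg hf hv x h c u)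
    (fun c u => smul_coloredMultilinear_add_sum hz leg hf hv x _ c u) hu (fun i => ?_) ?_
    (fun i => ?_) k
  · have hfl : f ≠ (leg i.succ).1 := fun e' => hf.not_isLeg (e' ▸ (leg i.succ).2)
    refine coloredGlue_congr (z := z) (b := b) (G := G.cut f) hfl fun (a : G.Dart) ha => ?_
    by_cases hae : a = G.edge f
    · subst hae
      simp
    · rw [Function.update_of_ne hae, Function.update_of_ne hae]
      by_cases hl : G.IsLeg a
      · rw [legColors_update leg x c i v hl, Function.update_of_ne ha]
      · rw [legColors, dif_neg hl, legColors, dif_neg hl]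
  · by_cases hi : i ∈ T <;> simp [hi, he, hvi]
  · simp only [LinearMap.sub_apply, LinearMap.smul_apply, smul_eq_mul]
    ring
  · by_cases hi : i ∈ T <;> simp [hi, he, hvi, hle, hlv]

end BraneGraph.UTGraph

/-! ### The theorem -/

theorem corollary4 {M : Type*} [TopologicalSpace M] [T2Space M] [CompactSpace M]
    [ChartedSpace (EuclideanSpace ℝ (Fin 3)) M]
    (z : Chain 3 M) (hz : IsFundamentalCycle z)
    {ι : Type*} [Finite ι] (b : FramedLink ι M) (hb : b.H1Spanning)
    (G : UTGraph ι) {r : ℕ} (leg : Fin (r + 1) ≃ G.Leg)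
    (x : ι →₀ ℤ) (hx : G.color (leg 0).1 = x)
    (y : Fin r → (ι →₀ ℤ)) (hy : ∀ i, G.color (leg i.succ).1 = y i)
    (hprim : IsPrimitiveElement (b.cls x))
    (hlin : ∀ m : ℤ, m • b.cls x ∈ Submodule.span ℤ (Set.range fun i => b.cls (y i)) → m = 0) :
    ((∃ d, G.IsInternal d) → LinearIndependent ℤ (fun i => b.cls (y i)) →
      ∀ k ≤ r, replaceSum z b G leg k = 0) ∧
    ((∃ d, G.IsInternal d ∧ G.SameComponent (leg 0).1 d) →
      replaceSum z b G leg 0 = 0 ∧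
      (LinearIndepOn ℤ id (Set.range fun i => b.cls (y i)) →
        ∀ k ≤ r, replaceSum z b G leg k = 0)) := by
  have hfin : Module.Finite ℤ (H1 M) :=
    ⟨Submodule.fg_def.mpr ⟨_, Set.finite_range fun i => loopClass (b.core i), hb⟩⟩
  have hsurj : ∀ a : H1 M, ∃ c, b.cls c = a := by
    rw [← Function.Surjective, ← LinearMap.range_eq_top, FramedLink.cls,
      Finsupp.range_linearCombination]
    exact hb
  have hsum : ∀ k, replaceSum z b G leg k = ∑ S ∈ Finset.powersetCard k Finset.univ,
      UTGraph.coloredMultilinear z b leg x (S.piecewise (fun _ => x) y) := fun k => by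
    subst hx
    obtain rfl := funext hy
    exact Finset.sum_congr rfl fun S _ => UTGraph.replace_toOpenBrane leg S
  refine ⟨?_, ?_⟩
  · rintro ⟨f, hf⟩ hli k -
    rw [hsum]
    refine Finset.sum_eq_zero fun S _ => ?_
    refine UTGraph.colored_eq_zero_of_card_le hz.1 (fun C hC => ?_) hf (leg 0).2 (UTGraph.card_isLeg leg).le _
    obtain ⟨h, hs, hk⟩ :=
      exists_surjective_hom_of_card_lt_finrank (finrank_gt_of_linearIndependent hli hlin) C hC
    obtain ⟨a, ha⟩ := hs 1
    obtain ⟨u, rfl⟩ := hsurj a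
    exact ⟨h, u, ha, hk⟩
  · rintro ⟨f₀, hf₀, hc⟩
    obtain ⟨f, hf, hv⟩ := UTGraph.exists_internal_adjacent hf₀ hc
    obtain ⟨h, hs, hk⟩ := exists_surjective_hom_vanishing _ hlin
    obtain ⟨a, ha⟩ := hs 1
    obtain ⟨u, rfl⟩ := hsurj a
    have hky : ∀ i, h (b.cls (y i)) = 0 := fun i => hk _ ⟨1, one_ne_zero, by
      rw [one_smul]; exact Submodule.subset_span ⟨i, rfl⟩⟩
    have hzero : replaceSum z b G leg 0 = 0 := by
      rw [hsum, Finset.powersetCard_zero, Finset.sum_singleton, Finset.piecewise_empty]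
      refine UTGraph.colored_eq_zero_of_adjacent hz.1 hf (leg 0).2 hv ha ?_
      rw [UTGraph.forall_isLeg_iff leg]
      refine ⟨fun e => absurd rfl e, fun i _ => ?_⟩
      rw [UTGraph.legColors_succ, hky]
    refine ⟨hzero, fun hli k hkr => ?_⟩
    -- Without any `y_i` the span is zero and contains no `e` with `l(e) = 1`; but then only `k = 0`
    -- occurs.
    rcases Nat.eq_zero_or_pos r with rfl | hr
    · obtain rfl := Nat.le_zero.mp hkr
      exact hzero
    obtain ⟨r, rfl⟩ := Nat.exists_eq_succ_of_ne_zero hr.ne'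
    obtain ⟨d, e, l, hle, hly, hem⟩ := exists_hom_constant_on_independent _ hli
    obtain ⟨e, rfl⟩ := hsurj e
    -- Here it matters that `h` vanishes on the whole saturation of the span.
    have he : h (b.cls e) = 0 := hk _ hem
    have key := UTGraph.sum_replace_eq_zero hz.1 leg hf hv x e u d (fun i => y i - d • e) h l ha he
      (fun i => by simp [hky, he]) hle (fun i => by simp [hly, hle]) k
    rw [hsum, ← key]
    simp
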